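/- Let $G$ be a finite simple biconnected graph, i.e. $G$ has at least three vertices, is connected, and remains connected after the deletion of any single vertex. Let $G$ be embedded in the plane, the embedding being given combinatorially: a combinatorial embedding (rotation system) prescribes for every vertex a cyclic order of the oriented edges leaving it; its faces are the orbits of the face-tracing permutation, which sends an oriented edge $(u,v)$ to the successor of $(v,u)$ in the cyclic order at $v$; and it is planar if Euler's formula $|V|-|E|+|F|=2$ holds, where $F$ is the set of faces. For a spanning tree $T$ of $G$ and an edge $e\in E(G)\setminus E(T)$, the fundamental cycle $C(e)$ is the unique cycle of $T\cup\{e\}$. Then for every spanning tree $T$ of $G$ the embedding has a fundamental face with respect to $T$: there are a face $f$ and an edge $e\in E(G)\setminus E(T)$ such that the boundary walk of $f$ is a cycle (it repeats no vertex) and this cycle is $C(e)$. -/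

import Mathlib

namespace EmbeddedGraph

variable {V : Type*} {G : SimpleGraph V}

/-- A graph is biconnected (2-connected) if it has at least three vertices, is connected, and stays
connected after the deletion of any one vertex. -/
structure IsBiconnected (G : SimpleGraph V) : Prop where
  three_le_card : 3 ≤ Nat.card V
  connected : G.Connected
  connected_delete : ∀ v : V, (G.induce {v}ᶜ).Connected

/-- A combinatorial embedding (rotation system) of a graph: for every vertex, a cyclic order of the
darts (oriented edges) that leave it. The orders are collected in one permutation `rot` of the
darts, whose cycles are exactly the sets of darts with a common tail. -/
structure CombEmbedding (G : SimpleGraph V) where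
  rot : Equiv.Perm G.Dart
  fst_rot : ∀ d, (rot d).fst = d.fst
  sameCycle_rot : ∀ d d' : G.Dart, d.fst = d'.fst → rot.SameCycle d d'

namespace CombEmbedding

variable (R : CombEmbedding G)

/-- Reversal of darts, as a permutation. -/
def rev (G : SimpleGraph V) : Equiv.Perm G.Dart :=
  Function.Involutive.toPerm SimpleGraph.Dart.symm SimpleGraph.Dart.symm_involutive

/-- Face tracing: after traversing the dart `d = (u, v)`, leave `v` along the dart that follows
`(v, u)` in the cyclic order at `v`. -/
def next : Equiv.Perm G.Dart := (rev G).trans R.rot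

/-- The faces of a combinatorial embedding are the orbits of the face tracing permutation. -/
def Face : Type _ := Quotient (Equiv.Perm.SameCycle.setoid R.next)

/-- The face on whose boundary walk the dart `d` lies. -/
def faceOf (d : G.Dart) : R.Face := Quotient.mk _ d

/-- A combinatorial embedding of a finite connected graph (with at least one edge) is planar if it
satisfies Euler's formula `|V| - |E| + |F| = 2`, that is, if its genus is zero. -/
def IsPlanar : Prop :=
  (Nat.card V : ℤ) - (Nat.card G.edgeSet : ℤ) + (Nat.card R.Face : ℤ) = 2

/-- The closed walk `c` is a boundary cycle of the face `F`: it is a cycle (no repeated vertices)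
and the darts it traverses are exactly the darts of the face. -/
def IsBoundaryCycle (F : R.Face) {u : V} (c : G.Walk u u) : Prop :=
  c.IsCycle ∧ ∀ d : G.Dart, d ∈ c.darts ↔ R.faceOf d = F

end CombEmbedding

/-- `T` is a spanning tree of `G` (a tree on all vertices, all of whose edges are edges of `G`). -/
def IsSpanningTree (G T : SimpleGraph V) : Prop :=
  T ≤ G ∧ T.IsTree

/-- `c` is a cycle of `G` all of whose edges lie in `T + e`. If `T` is a spanning tree of `G` and
`e` is an edge of `G` outside `T`, this says that `c` is (a traversal of) the fundamental cycle
of `e` with respect to `T`. -/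
def IsFundamentalCycle (T : SimpleGraph V) (e : Sym2 V) {u : V} (c : G.Walk u u) : Prop :=
  c.IsCycle ∧ ∀ e' ∈ c.edges, e' ∈ T.edgeSet ∨ e' = e

/-- The face `F` is fundamental with respect to the spanning tree `T`: it is bounded by a cycle, and
that cycle is the fundamental cycle of some edge of `G` outside `T`. -/
def CombEmbedding.IsFundamentalFace (R : CombEmbedding G) (T : SimpleGraph V) (F : R.Face) : Prop :=
  ∃ e ∈ G.edgeSet \ T.edgeSet, ∃ (u : V) (c : G.Walk u u),
    IsFundamentalCycle T e c ∧ R.IsBoundaryCycle F c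

end EmbeddedGraph

/-! Count darts outside `T`. There are 2(|E| - |V| + 1) of them, which Euler's formula turns into
2(|F| - 1), so some face carries at most one (`exists_face_subsingleton_not_adj`). Biconnectedness
forbids backtracking along a face boundary, and a non-backtracking walk in a tree is a path
(`isPath_of_darts_eq_iterate`). Hence no closed boundary walk lies in `T`, and the chosen face has
exactly one non-tree dart; the rest of its boundary is a tree path, which that dart closes to a
fundamental cycle. -/

namespace EmbeddedGraph

variable {V : Type*} {G T : SimpleGraph V}

/-- In a biconnected graph every vertex has degree at least two. -/
theorem IsBiconnected.exists_adj_ne [Finite V] (hG : IsBiconnected G) {u v : V} (huv : u ≠ v) :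
    ∃ w, G.Adj v w ∧ w ≠ u := by
  -- Deleting `u` leaves a connected graph on at least two vertices, so `v` keeps a neighbour there.
  have : Nontrivial ({u}ᶜ : Set V) := by
    rw [← Finite.one_lt_card_iff_nontrivial]
    have h := Set.ncard_add_ncard_compl {u}
    rw [Set.ncard_singleton, ← Nat.card_coe_set_eq] at h
    have := hG.three_le_card
    omega
  obtain ⟨w, hw⟩ := (hG.connected_delete u).preconnected.exists_adj_of_nontrivial ⟨v, huv.symm⟩
  exact ⟨w, hw, w.2⟩

/-- The darts of a finite graph outside a spanning tree: there are two for each edge outside the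
tree, and `|E| - |V| + 1` such edges. -/
theorem IsSpanningTree.card_darts_not_adj [Fintype V] [DecidableRel G.Adj] [DecidableRel T.Adj]
    (hT : IsSpanningTree G T) :
    (({d : G.Dart | ¬ T.Adj d.fst d.snd} : Finset G.Dart).card : ℤ) =
      2 * (Nat.card G.edgeSet - Nat.card V + 1) := by
  classical
  have hG := G.dart_card_eq_twice_card_edges
  have hTd := T.dart_card_eq_twice_card_edges
  have hTV := hT.2.card_edgeFinset
  have hsplit := Finset.card_filter_add_card_filter_not (s := (Finset.univ : Finset G.Dart))
    (fun d => T.Adj d.fst d.snd)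
  have hmem : ({d : G.Dart | T.Adj d.fst d.snd} : Finset G.Dart).card = Fintype.card T.Dart := by
    rw [← Fintype.card_subtype]
    exact Fintype.card_congr
      { toFun := fun d => ⟨d.1.toProd, d.2⟩
        invFun := fun d => ⟨⟨d.toProd, hT.1 d.adj⟩, d.adj⟩
        left_inv := fun _ => rfl
        right_inv := fun _ => rfl }
  have hE : Nat.card G.edgeSet = G.edgeFinset.card := by
    rw [Nat.card_eq_fintype_card, SimpleGraph.edgeFinset_card]
  have huniv : (Finset.univ : Finset G.Dart).card = 2 * G.edgeFinset.card := by
    rw [← hG, Finset.card_univ]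
  rw [hE, Nat.card_eq_fintype_card]
  omega

namespace CombEmbedding

variable (R : CombEmbedding G)

theorem fst_next (d : G.Dart) : (R.next d).fst = d.snd :=
  R.fst_rot d.symm

theorem faceOf_eq_iff {d d' : G.Dart} : R.faceOf d = R.faceOf d' ↔ R.next.SameCycle d d' :=
  Quotient.eq

theorem faceOf_iterate_next (d : G.Dart) (n : ℕ) : R.faceOf (R.next^[n] d) = R.faceOf d := by
  rw [faceOf_eq_iff, ← Equiv.Perm.coe_pow]
  exact Equiv.Perm.sameCycle_pow_left.2 (Equiv.Perm.SameCycle.refl _ _)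

/-- The boundary of a face of a biconnected graph never backtracks. -/
theorem edge_ne_edge_next [Finite V] (hG : IsBiconnected G) (d : G.Dart) :
    d.edge ≠ (R.next d).edge := by
  intro h
  -- Backtracking would make `d.symm` a fixed point of the rotation, hence the only dart leaving
  -- `d.snd`.
  have hfix : R.rot d.symm = d.symm := by
    rcases SimpleGraph.dart_edge_eq_iff d (R.next d) |>.1 h with h' | h'
    · exact absurd (congrArg (·.fst) h') (by simp [fst_next])
    · exact (SimpleGraph.Dart.symm_symm _).symm.trans (congrArg SimpleGraph.Dart.symm h'.symm)
  obtain ⟨w, hw, hne⟩ := hG.exists_adj_ne d.fst_ne_snd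
  have hs : R.rot.SameCycle d.symm ⟨(d.snd, w), hw⟩ := R.sameCycle_rot _ _ rfl
  obtain ⟨i, hi⟩ := hs
  rw [Equiv.Perm.zpow_apply_eq_self_of_apply_eq_self hfix] at hi
  exact hne (congrArg (·.snd) hi).symm

theorem isChain_edges_iterate_next [Finite V] (hG : IsBiconnected G) (n : ℕ) (d : G.Dart) :
    List.IsChain (· ≠ ·) ((List.iterate R.next d n).map SimpleGraph.Dart.edge) := by
  induction n generalizing d with
  | zero => simp
  | succ n ih =>
    cases n with
    | zero => simp
    | succ n => exact List.isChain_cons_cons.2 ⟨R.edge_ne_edge_next hG d, ih (R.next d)⟩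

/-- The walk that follows the boundary of a face for `n` steps. -/
theorem exists_walk_darts_eq_iterate (n : ℕ) (d : G.Dart) :
    ∃ p : G.Walk d.fst (R.next^[n] d).fst, p.darts = List.iterate R.next d n := by
  induction n generalizing d with
  | zero => exact ⟨.nil, rfl⟩
  | succ n ih =>
    obtain ⟨p, hp⟩ := ih (R.next d)
    exact ⟨.cons d.adj (p.copy (R.fst_next d) rfl), by simp [hp, List.iterate, fst_next]⟩

/-- A stretch of a face boundary that uses tree edges only is a path. -/
theorem isPath_of_darts_eq_iterate [Finite V] (hG : IsBiconnected G) (hT : IsSpanningTree G T)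
    {n : ℕ} {d : G.Dart} {u v : V} {p : G.Walk u v} (hp : p.darts = List.iterate R.next d n)
    (hadj : ∀ i < n, T.Adj (R.next^[i] d).fst (R.next^[i] d).snd) :
    (∀ e ∈ p.edges, e ∈ T.edgeSet) ∧ p.IsPath := by
  have hmem : ∀ e ∈ p.edges, e ∈ T.edgeSet := by
    intro e he
    rw [SimpleGraph.Walk.edges_eq_map_darts, hp, List.mem_map] at he
    obtain ⟨d', hd', rfl⟩ := he
    obtain ⟨i, hi, rfl⟩ := List.mem_iterate.1 hd'
    exact hadj i hi
  refine ⟨hmem, ?_⟩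
  -- The chain criterion for paths needs an acyclic graph, so the walk is moved into `T`.
  have hpath : (p.transfer T hmem).IsPath := by
    rw [hT.2.isAcyclic.isPath_iff_isChain, SimpleGraph.Walk.edges_transfer,
      SimpleGraph.Walk.edges_eq_map_darts, hp]
    exact R.isChain_edges_iterate_next hG n d
  rw [SimpleGraph.Walk.isPath_def] at hpath ⊢
  rwa [SimpleGraph.Walk.support_transfer] at hpath

theorem minimalPeriod_next_pos [Finite V] (d : G.Dart) :
    0 < Function.minimalPeriod R.next d := by
  classical
  have : Fintype V := Fintype.ofFinite V
  exact Function.minimalPeriod_pos_of_mem_periodicPts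
    (R.next.injective.mem_periodicPts d)

theorem faceOf_eq_iff_exists_lt [Finite V] {d d' : G.Dart} :
    R.faceOf d' = R.faceOf d ↔ ∃ i < Function.minimalPeriod R.next d, R.next^[i] d = d' := by
  classical
  have : Fintype V := Fintype.ofFinite V
  constructor
  · intro h
    obtain ⟨i, -, hi⟩ := (R.faceOf_eq_iff.1 h.symm).exists_pow_eq'
    refine ⟨i % Function.minimalPeriod R.next d, Nat.mod_lt _ (R.minimalPeriod_next_pos d), ?_⟩
    rw [Function.iterate_mod_minimalPeriod_eq, ← hi, Equiv.Perm.coe_pow]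
  · rintro ⟨i, -, rfl⟩
    exact R.faceOf_iterate_next d i

/-- Not all edges on the boundary of a face belong to a spanning tree. -/
theorem exists_not_adj_of_face [Finite V] (hG : IsBiconnected G) (hT : IsSpanningTree G T)
    (d : G.Dart) : ∃ d', R.faceOf d' = R.faceOf d ∧ ¬ T.Adj d'.fst d'.snd := by
  by_contra! h
  obtain ⟨p, hp⟩ := R.exists_walk_darts_eq_iterate (Function.minimalPeriod R.next d) d
  have hpath := (R.isPath_of_darts_eq_iterate hG hT hp
    fun i _ => h _ (R.faceOf_iterate_next d i)).2
  have hlen : p.length = Function.minimalPeriod R.next d := by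
    rw [← SimpleGraph.Walk.length_darts, hp, List.length_iterate]
  have hper : R.next^[Function.minimalPeriod R.next d] d = d := Function.iterate_minimalPeriod
  -- After a full period the walk is closed, and a closed path has length zero.
  have hnil : (p.copy rfl (congrArg (·.fst) hper)).IsPath := by
    rwa [SimpleGraph.Walk.isPath_copy]
  have := SimpleGraph.Walk.length_eq_zero_iff.2 (SimpleGraph.Walk.isPath_iff_nil.1 hnil)
  rw [SimpleGraph.Walk.length_copy, hlen] at this
  exact (R.minimalPeriod_next_pos d).ne' this

/-- A face with exactly one boundary dart outside the spanning tree is fundamental. -/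
theorem isFundamentalFace_of_unique [Finite V] (hG : IsBiconnected G) (hT : IsSpanningTree G T)
    {d : G.Dart} (hd : ¬ T.Adj d.fst d.snd)
    (huniq : ∀ d', R.faceOf d' = R.faceOf d → ¬ T.Adj d'.fst d'.snd → d' = d) :
    R.IsFundamentalFace T (R.faceOf d) := by
  -- The period is `k + 1`: the dart `d`, then the `k` darts from `d.snd` back to `d.fst`.
  obtain ⟨k, hk⟩ := Nat.exists_eq_succ_of_ne_zero (R.minimalPeriod_next_pos d).ne'
  have hper : R.next^[k] (R.next d) = d := by
    rw [← Function.iterate_succ_apply, ← hk, Function.iterate_minimalPeriod]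
  obtain ⟨p, hp⟩ := R.exists_walk_darts_eq_iterate k (R.next d)
  obtain ⟨hmem, hpath⟩ := R.isPath_of_darts_eq_iterate hG hT hp (by
    intro i hi
    by_contra hcon
    rw [← Function.iterate_succ_apply] at hcon
    have := huniq _ (R.faceOf_iterate_next d _) hcon
    -- A second non-tree dart would be `d` itself, recurring before its minimal period.
    exact Function.not_isPeriodicPt_of_pos_of_lt_minimalPeriod (Nat.succ_ne_zero i)
      (by omega) this)
  let q : G.Walk d.snd d.fst := p.copy (R.fst_next d) (congrArg (·.fst) hper)
  have hqe : q.edges = p.edges := SimpleGraph.Walk.edges_copy ..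
  refine ⟨d.edge, ⟨d.edge_mem, hd⟩, d.fst, .cons d.adj q, ?_⟩
  have hcyc : (SimpleGraph.Walk.cons d.adj q).IsCycle := by
    rw [SimpleGraph.Walk.cons_isCycle_iff, hqe]
    exact ⟨by simpa [q] using hpath, fun h => hd (hmem _ h)⟩
  refine ⟨⟨hcyc, ?_⟩, hcyc, fun d' => ?_⟩
  · intro e he
    rw [SimpleGraph.Walk.edges_cons, hqe, List.mem_cons] at he
    exact he.symm.imp (hmem e) id
  · have : (SimpleGraph.Walk.cons d.adj q).darts =
        List.iterate R.next d (Function.minimalPeriod R.next d) := by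
      simp [q, hp, hk, List.iterate, fst_next]
    rw [this, List.mem_iterate, R.faceOf_eq_iff_exists_lt]
    simp [eq_comm]

/-- By Euler's formula some face has at most one boundary dart outside the spanning tree. -/
theorem exists_face_subsingleton_not_adj [Finite V] (hR : R.IsPlanar)
    (hT : IsSpanningTree G T) :
    ∃ F : R.Face, ∀ d d' : G.Dart, R.faceOf d = F → R.faceOf d' = F →
      ¬ T.Adj d.fst d.snd → ¬ T.Adj d'.fst d'.snd → d = d' := by
  classical
  have : Fintype V := Fintype.ofFinite V
  have : Finite R.Face := Quotient.finite _
  have : Fintype R.Face := Fintype.ofFinite _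
  have hcard := hT.card_darts_not_adj
  have hlt : ({d : G.Dart | ¬ T.Adj d.fst d.snd} : Finset G.Dart).card <
      (Finset.univ : Finset R.Face).card • 2 := by
    unfold IsPlanar at hR
    rw [Finset.card_univ, ← Nat.card_eq_fintype_card, smul_eq_mul]
    omega
  obtain ⟨F, -, hF⟩ := Finset.exists_card_fiber_lt_of_card_lt_nsmul (f := R.faceOf) hlt
  refine ⟨F, fun d d' hd hd' hdT hdT' => Finset.card_le_one.1 (Nat.lt_succ_iff.1 hF) d ?_ d' ?_⟩
  · simp [hd, hdT]
  · simp [hd', hdT']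

end CombEmbedding

end EmbeddedGraph

theorem mainTheorem7 {V : Type*} [Finite V] (G : SimpleGraph V)
    (hG : EmbeddedGraph.IsBiconnected G)
    (R : EmbeddedGraph.CombEmbedding G) (hR : R.IsPlanar)
    (T : SimpleGraph V) (hT : EmbeddedGraph.IsSpanningTree G T) :
    ∃ F : R.Face, R.IsFundamentalFace T F := by
  obtain ⟨F, hF⟩ := R.exists_face_subsingleton_not_adj hR hT
  obtain ⟨d, rfl⟩ := Quotient.exists_rep F
  obtain ⟨d', hd', hdT⟩ := R.exists_not_adj_of_face hG hT d
  have hrep : (Quotient.mk _ d : R.Face) = R.faceOf d' := hd'.symm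
  rw [hrep] at hF
  exact ⟨R.faceOf d', R.isFundamentalFace_of_unique hG hT hdT
    fun d'' h h' => hF d'' d' h rfl h' hdT⟩
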